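/- \textbf{Theorem 1 (Correctness).} Fix an alphabet of function symbols, predicate symbols and infinitely many variables. A program $P$ is a set of definite clauses over this alphabet. Substitutions move only finitely many variables. A unifier $\theta$ of two expressions is a most general unifier (mgu) if every unifier of them is of the form $\theta\gamma$ for a substitution $\gamma$. An atom $A$ belongs to $\mathcal O(P)$, the s-semantics of $P$, iff $A=p(V_1,\dots,V_n)\theta$ for some $n$-ary predicate symbol $p$, distinct variables $V_1,\dots,V_n$ and some SLD-computed answer substitution $\theta$ of $P$ for the query $p(V_1,\dots,V_n)$. For a set $I$ of (not necessarily ground) atoms, $T^\pi_P(I)$ is the set of all atoms $H\theta$ such that $\theta$ is an mgu of $(B_1,\dots,B_n)$ and $(A_1,\dots,A_n)$ for some clause $(H\gets B_1,\dots,B_n)\in P$ and some $A_1,\dots,A_n\in I$ for which the $n+1$ expressions $A_1,\dots,A_n,(H\gets B_1,\dots,B_n)$ are pairwise variable disjoint. The program $P$ is correct with respect to a set $S$ of atoms if $\mathcal O(P)\subseteq S$. Let $P$ be a program and $S$ a set of atoms. \begin{enumerate} \item If $T^\pi_P(S)\subseteq S$ then $\mathcal O(P)\subseteq S$, i.e.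 $P$ is correct with respect to $S$. \item If $T^\pi_{\{C\}}(S)\subseteq S$ for each clause $C\in P$, then $\mathcal O(P)\subseteq S$, i.e. $P$ is correct with respect to $S$. \end{enumerate} Moreover, the premises of the two implications are equivalent. -/

import Mathlib

universe u v w

namespace SSem

/-- An atom `p(t₁,…,tₙ)` over the alphabet consisting of the function and predicate (relation)
symbols of `L` and the variables `V`. -/
@[ext]
structure Atom (L : FirstOrder.Language.{u, v}) (V : Type w) where
  arity : ℕ
  pred : L.Relations arity
  args : Fin arity → L.Term V

/-- A query is a finite sequence (conjunction) of atoms; `[]` is the empty query. -/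
abbrev Query (L : FirstOrder.Language.{u, v}) (V : Type w) := List (Atom L V)

/-- A definite clause `head ← body`. -/
@[ext]
structure Clause (L : FirstOrder.Language.{u, v}) (V : Type w) where
  head : Atom L V
  body : Query L V

/-- A definite program is a set of definite clauses. -/
abbrev Program (L : FirstOrder.Language.{u, v}) (V : Type w) := Set (Clause L V)

/-- A substitution: a mapping from variables to terms that moves only finitely many variables. -/
@[ext]
structure Subst (L : FirstOrder.Language.{u, v}) (V : Type w) where
  toFun : V → L.Term V
  finite_dom : {x | toFun x ≠ FirstOrder.Language.Term.var x}.Finite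

variable {L : FirstOrder.Language.{u, v}} {V : Type w}

namespace Subst

/-- The empty (identity) substitution. -/
def id : Subst L V where
  toFun := FirstOrder.Language.Term.var
  finite_dom := by simp

/-- The composition `θη`: first `θ`, then `η`. -/
def comp (θ η : Subst L V) : Subst L V where
  toFun x := (θ.toFun x).subst η.toFun
  finite_dom := by
    refine (θ.finite_dom.union η.finite_dom).subset ?_
    intro x hx
    by_contra h
    simp only [Set.mem_union, Set.mem_ofPred_eq, not_or, not_not] at h
    apply hx
    simp [h.1, h.2, FirstOrder.Language.Term.subst]

/-- A renaming: a substitution that acts as a permutation of the variables. -/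
def IsRenaming (θ : Subst L V) : Prop :=
  ∃ π : Equiv.Perm V, ∀ x, θ.toFun x = FirstOrder.Language.Term.var (π x)

end Subst

open Classical in
/-- The set of variables occurring in a term. -/
def termVars (t : L.Term V) : Set V := (t.varFinset : Set V)

/-- The variables of a substitution: those it moves, and those occurring in their images. -/
def Subst.vars (θ : Subst L V) : Set V :=
  {x | θ.toFun x ≠ FirstOrder.Language.Term.var x} ∪
    ⋃ x ∈ {x | θ.toFun x ≠ FirstOrder.Language.Term.var x}, termVars (θ.toFun x)

/-- Application of a substitution to an atom. -/
def Atom.subst (A : Atom L V) (θ : Subst L V) : Atom L V where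
  arity := A.arity
  pred := A.pred
  args i := (A.args i).subst θ.toFun

def Atom.vars (A : Atom L V) : Set V := ⋃ i, termVars (A.args i)

/-- Application of a substitution to a query. -/
def Query.subst (Q : Query L V) (θ : Subst L V) : Query L V := Q.map (fun A => A.subst θ)

def Query.vars (Q : Query L V) : Set V := ⋃ A ∈ Q, Atom.vars A

/-- Application of a substitution to a clause. -/
def Clause.subst (C : Clause L V) (θ : Subst L V) : Clause L V where
  head := C.head.subst θ
  body := Query.subst C.body θ

def Clause.vars (C : Clause L V) : Set V := C.head.vars ∪ Query.vars C.body

/-- `C'` is a variant of `C`. -/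
def Clause.IsVariant (C' C : Clause L V) : Prop :=
  ∃ ρ : Subst L V, ρ.IsRenaming ∧ C' = C.subst ρ

/-- `θ` unifies the sequences of atoms `E` and `F` (position by position). -/
def IsUnifier (θ : Subst L V) (E F : Query L V) : Prop :=
  Query.subst E θ = Query.subst F θ

/-- `θ` is a most general unifier of `E` and `F`: a unifier such that every
unifier is of the form `θγ`. -/
def IsMGU (θ : Subst L V) (E F : Query L V) : Prop :=
  IsUnifier θ E F ∧ ∀ η : Subst L V, IsUnifier η E F → ∃ γ : Subst L V, η = θ.comp γ

/-- `SLDStep C' Q θ Q'`: with input clause `C'`, variable disjoint from `Q`, some atom of `Q` is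
selected, `θ` is an mgu of it and the head of `C'`, and `Q'` is the resulting SLD-resolvent. -/
inductive SLDStep (C' : Clause L V) : Query L V → Subst L V → Query L V → Prop
  | intro (pre post : Query L V) (B : Atom L V) (θ : Subst L V)
      (hdisj : Disjoint C'.vars (Query.vars (pre ++ B :: post)))
      (hmgu : IsMGU θ [B] [C'.head]) :
      SLDStep C' (pre ++ B :: post) θ (Query.subst (pre ++ C'.body ++ post) θ)

/-- `SLDDerivation P Q₀ Q σ U`: there is a finite SLD-derivation of `P` from `Q₀` to `Q`, in which
`σ = θ₁⋯θₖ` is the composition of the mgus used, and `U` is the set of the variables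
of `Q₀`, of the input clauses used and of the mgus used. Input clauses are variants of clauses of
`P`, standardized apart from all of `U`. Any atom may be selected in each step. -/
inductive SLDDerivation (P : Program L V) (Q₀ : Query L V) :
    Query L V → Subst L V → Set V → Prop
  | start : SLDDerivation P Q₀ Q₀ Subst.id (Query.vars Q₀)
  | step {Q Q' : Query L V} {σ θ : Subst L V} {U : Set V} {C C' : Clause L V}
      (hder : SLDDerivation P Q₀ Q σ U)
      (hC : C ∈ P) (hvar : C'.IsVariant C)
      (hapart : Disjoint C'.vars U)
      (hstep : SLDStep C' Q θ Q') :
      SLDDerivation P Q₀ Q' (σ.comp θ) (U ∪ C'.vars ∪ θ.vars)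

/-- `Q'` is an SLD-computed answer for `Q`: `Q' = Qθ₁⋯θₖ` for a successful SLD-derivation (one
ending in the empty query) with mgus `θ₁,…,θₖ`. (Restricting `θ₁⋯θₖ` to the variables of `Q`, to
get the computed answer substitution, does not change `Qθ₁⋯θₖ`.) -/
def IsComputedAnswer (P : Program L V) (Q Q' : Query L V) : Prop :=
  ∃ (σ : Subst L V) (U : Set V), SLDDerivation P Q [] σ U ∧ Q' = Query.subst Q σ

/-- The most general atom `p(V₁,…,Vₙ)`. -/
def Atom.ofVars {n : ℕ} (p : L.Relations n) (x : Fin n → V) : Atom L V where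
  arity := n
  pred := p
  args i := FirstOrder.Language.Term.var (x i)

/-- The s-semantics `O(P)`: the atoms that are SLD-computed answers for
queries `p(V₁,…,Vₙ)`, with `V₁,…,Vₙ` distinct variables. -/
def sSemantics (P : Program L V) : Set (Atom L V) :=
  {A | ∃ (n : ℕ) (p : L.Relations n) (x : Fin n → V), Function.Injective x ∧
    IsComputedAnswer P [Atom.ofVars p x] [A]}

/-- The s-semantics immediate consequence operator `T^π_P`. The atoms `A₁,…,Aₙ` and the clause are
required to be pairwise variable disjoint. -/
def TPi (P : Program L V) (I : Set (Atom L V)) : Set (Atom L V) :=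
  {A | ∃ C ∈ P, ∃ As : List (Atom L V), (∀ B ∈ As, B ∈ I) ∧
    As.Pairwise (fun B B' => Disjoint B.vars B'.vars) ∧
    (∀ B ∈ As, Disjoint B.vars C.vars) ∧
    ∃ θ : Subst L V, IsMGU θ C.body As ∧ A = C.head.subst θ}

/-- `P` is correct w.r.t. the specification `S`. -/
def IsCorrect (P : Program L V) (S : Set (Atom L V)) : Prop := sSemantics P ⊆ S

end SSem

namespace SSem

open FirstOrder.Language (Term)

variable {L : FirstOrder.Language.{u, v}} {V : Type w}

/-! A successful SLD-derivation is read from its end back to its start. The invariant is that the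
current query has a most general unifier `μ` with a list of atoms that come from `S`, are pairwise
variable disjoint, and are fresh for everything used so far. At the empty query the list is empty
and `μ` is the identity. Undoing a resolution step (`SLDStep.exists_isApart`) replaces the atoms
matched with the clause body by one atom, a renamed consequence of them under the clause; the
instance of the earlier variables given by the mgu and `μ` is preserved. At the initial query
`p(V₁,…,Vₙ)` one atom `A` remains, and the computed answer is the most general common instance of
`p(V₁,…,Vₙ)` and `A`, hence a variant of `A` (`subst_ofVars_mem`).

Two points need care. `S` need not be closed under renaming, whereas input clauses and retained
atoms are renamed freely. So the invariant uses `variantCore S`; closure of `S` under `T^π_P` makes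
the core closed as well, since a renaming can be absorbed into an mgu
(`head_subst_mem_variantCore`). Also, the variables of an undone input clause no longer occur in the
problem, so generality of `μ` is claimed only on a set of relevant variables (`IsMGUOn`).

Undoing a step requires an mgu of the clause body and its atoms alone, which exists by the
unification theorem `exists_isMGU`. The clausewise premise is equivalent to the global one because
each consequence uses a single clause. -/

/-! ### Terms, substitutions and renamings. -/

theorem mem_termVars_var {x y : V} : y ∈ termVars (Term.var x : L.Term V) ↔ y = x := by
  simp [termVars]

theorem mem_termVars_func {n : ℕ} {f : L.Functions n} {ts : Fin n → L.Term V} {y : V} :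
    y ∈ termVars (Term.func f ts) ↔ ∃ i, y ∈ termVars (ts i) := by
  simp [termVars]

theorem termVars_finite (t : L.Term V) : (termVars t).Finite := by
  classical
  exact Finset.finite_toSet _

theorem term_subst_eq_iff {t : L.Term V} {f g : V → L.Term V} :
    t.subst f = t.subst g ↔ ∀ x ∈ termVars t, f x = g x := by
  induction t with
  | var x => simp [mem_termVars_var, Term.subst]
  | func F ts ih =>
    simp only [Term.subst, Term.func.injEq, heq_eq_eq, true_and, funext_iff, ih,
      mem_termVars_func]
    exact ⟨fun h x ⟨i, hi⟩ => h i x hi, fun h i x hi => h x ⟨i, hi⟩⟩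

theorem term_subst_subst (t : L.Term V) (f g : V → L.Term V) :
    (t.subst f).subst g = t.subst (fun x => (f x).subst g) := by
  induction t with
  | var x => rfl
  | func F ts ih => simp [Term.subst, ih]

theorem term_subst_var (t : L.Term V) : t.subst Term.var = t := by
  induction t with
  | var x => rfl
  | func F ts ih => simp [Term.subst, ih]

theorem mem_termVars_subst {t : L.Term V} {f : V → L.Term V} {y : V} :
    y ∈ termVars (t.subst f) ↔ ∃ x ∈ termVars t, y ∈ termVars (f x) := by
  induction t with
  | var x => simp [mem_termVars_var, Term.subst]
  | func F ts ih =>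
    simp only [Term.subst, mem_termVars_func, ih]
    tauto

namespace Subst

theorem comp_toFun (θ η : Subst L V) (x : V) :
    (θ.comp η).toFun x = (θ.toFun x).subst η.toFun := rfl

theorem comp_assoc (θ η γ : Subst L V) : (θ.comp η).comp γ = θ.comp (η.comp γ) := by
  ext x
  simp only [comp_toFun, term_subst_subst]
  rfl

theorem id_comp (θ : Subst L V) : Subst.id.comp θ = θ := rfl

theorem comp_id (θ : Subst L V) : θ.comp Subst.id = θ := by
  ext x
  exact term_subst_var _

open Classical in
/-- The substitution that acts as `θ` on `s` and as `η` elsewhere. -/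
noncomputable def piecewise (s : Set V) (θ η : Subst L V) : Subst L V where
  toFun := s.piecewise θ.toFun η.toFun
  finite_dom := by
    refine (θ.finite_dom.union η.finite_dom).subset fun x hx => ?_
    by_cases h : x ∈ s
    · left; simpa [h] using hx
    · right; simpa [h] using hx

theorem piecewise_of_mem {s : Set V} (θ η : Subst L V) {x : V} (h : x ∈ s) :
    (piecewise s θ η).toFun x = θ.toFun x := by
  simp [piecewise, h]

theorem piecewise_of_notMem {s : Set V} (θ η : Subst L V) {x : V} (h : x ∉ s) :
    (piecewise s θ η).toFun x = η.toFun x := by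
  simp [piecewise, h]

/-- The substitution with domain in the finite set `s` that acts as `f` there. -/
noncomputable def ofFinite (s : Set V) (hs : s.Finite) (f : V → L.Term V) : Subst L V where
  toFun := open Classical in s.piecewise f Term.var
  finite_dom := by
    classical
    refine hs.subset fun x hx => ?_
    by_contra h
    exact hx (by simp [h])

theorem ofFinite_of_mem {s : Set V} (hs : s.Finite) (f : V → L.Term V) {x : V} (h : x ∈ s) :
    (ofFinite s hs f).toFun x = f x := by
  simp [ofFinite, h]

theorem ofFinite_of_notMem {s : Set V} (hs : s.Finite) (f : V → L.Term V) {x : V} (h : x ∉ s) :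
    (ofFinite s hs f).toFun x = Term.var x := by
  simp [ofFinite, h]

theorem vars_finite (θ : Subst L V) : θ.vars.Finite :=
  θ.finite_dom.union (θ.finite_dom.biUnion fun _ _ => termVars_finite _)

theorem eq_var_of_notMem_vars {θ : Subst L V} {x : V} (h : x ∉ θ.vars) :
    θ.toFun x = Term.var x := by
  by_contra hx
  exact h (Or.inl hx)

theorem termVars_toFun_subset (θ : Subst L V) (x : V) :
    termVars (θ.toFun x) ⊆ insert x θ.vars := by
  intro y hy
  by_cases hx : θ.toFun x = Term.var x
  · rw [hx, mem_termVars_var] at hy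
    exact Or.inl hy
  · exact Or.inr (Or.inr (Set.mem_biUnion (x := x) hx hy))

theorem IsRenaming.comp {ρ τ : Subst L V} (hρ : ρ.IsRenaming) (hτ : τ.IsRenaming) :
    (ρ.comp τ).IsRenaming := by
  obtain ⟨π, hπ⟩ := hρ
  obtain ⟨κ, hκ⟩ := hτ
  exact ⟨π.trans κ, fun x => by simp [comp_toFun, hπ, hκ, Term.subst]⟩

theorem IsRenaming.exists_inverse {ρ : Subst L V} (hρ : ρ.IsRenaming) :
    ∃ τ : Subst L V, τ.IsRenaming ∧ ρ.comp τ = Subst.id ∧ τ.comp ρ = Subst.id := by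
  obtain ⟨π, hπ⟩ := hρ
  refine ⟨⟨fun x => Term.var (π.symm x), ?_⟩, ⟨π.symm, fun _ => rfl⟩, ?_, ?_⟩
  · refine (ρ.finite_dom).subset fun x hx => ?_
    simp only [Set.mem_ofPred_eq, hπ, ne_eq, Term.var.injEq] at hx ⊢
    rwa [Equiv.symm_apply_eq, eq_comm] at hx
  · ext x
    simp [comp_toFun, hπ, Term.subst, Subst.id]
  · ext x
    simp [comp_toFun, hπ, Term.subst, Subst.id]

/-- An injective map on a finite set of variables extends to a renaming. -/
theorem exists_isRenaming_of_injOn {s : Set V} (hs : s.Finite) {f : V → V} (hf : s.InjOn f) :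
    ∃ ρ : Subst L V, ρ.IsRenaming ∧ ∀ x ∈ s, ρ.toFun x = Term.var (f x) := by
  classical
  -- The bijection from `s` to `f '' s` extends to a permutation of the finite set `s ∪ f '' s`, and
  -- then by the identity to all variables, so only finitely many variables move.
  have hK : (s ∪ f '' s).Finite := hs.union (hs.image f)
  have : Finite ↥(s ∪ f '' s) := hK
  let e₁ : {x : ↥(s ∪ f '' s) // x.1 ∈ s} ≃ s :=
    Equiv.subtypeSubtypeEquivSubtype (p := (· ∈ s ∪ f '' s)) (q := (· ∈ s)) Or.inl
  let e₂ : {x : ↥(s ∪ f '' s) // x.1 ∈ f '' s} ≃ f '' s :=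
    Equiv.subtypeSubtypeEquivSubtype (p := (· ∈ s ∪ f '' s)) (q := (· ∈ f '' s)) Or.inr
  let e := (e₁.trans (Equiv.Set.imageOfInjOn f s hf)).trans e₂.symm
  let π : Equiv.Perm V := Equiv.Perm.ofSubtype (e.extendSubtype)
  refine ⟨⟨fun x => Term.var (π x), hK.subset fun x hx => ?_⟩, ⟨π, fun _ => rfl⟩, fun x hx => ?_⟩
  · by_contra h
    exact hx (by rw [Equiv.Perm.ofSubtype_apply_of_not_mem _ h])
  · change (Term.var (Equiv.Perm.ofSubtype (e.extendSubtype) x) : L.Term V) = Term.var (f x)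
    congr 1
    have hx' : x ∈ s ∪ f '' s := Or.inl hx
    rw [Equiv.Perm.ofSubtype_apply_of_mem (p := (· ∈ s ∪ f '' s)) _ hx',
      Equiv.extendSubtype_apply_of_mem e _ hx]
    rfl

end Subst

/-! ### Substitutions acting on atoms and queries. -/

theorem Atom.subst_eq_subst_iff {A : Atom L V} {θ η : Subst L V} :
    A.subst θ = A.subst η ↔ Set.EqOn θ.toFun η.toFun A.vars := by
  simp only [Atom.subst, Atom.mk.injEq, heq_eq_eq, true_and, funext_iff, term_subst_eq_iff,
    Atom.vars, Set.EqOn, Set.mem_iUnion]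
  exact ⟨fun h x ⟨i, hi⟩ => h i x hi, fun h i x hi => h ⟨i, hi⟩⟩

theorem Atom.subst_comp (A : Atom L V) (θ η : Subst L V) :
    A.subst (θ.comp η) = (A.subst θ).subst η := by
  simp only [Atom.subst, term_subst_subst]
  rfl

theorem Atom.subst_id (A : Atom L V) : A.subst Subst.id = A := by
  simp only [Atom.subst, Subst.id, term_subst_var]

theorem Atom.mem_vars_subst {A : Atom L V} {θ : Subst L V} {y : V} :
    y ∈ (A.subst θ).vars ↔ ∃ x ∈ A.vars, y ∈ termVars (θ.toFun x) := by
  simp only [Atom.subst, Atom.vars, Set.mem_iUnion, mem_termVars_subst]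
  tauto

theorem Atom.vars_finite (A : Atom L V) : A.vars.Finite :=
  Set.finite_iUnion fun _ => termVars_finite _

namespace Query

theorem mem_vars {Q : Query L V} {x : V} : x ∈ Query.vars Q ↔ ∃ A ∈ Q, x ∈ A.vars := by
  simp [Query.vars]

theorem vars_append (Q R : Query L V) :
    Query.vars (Q ++ R) = Query.vars Q ∪ Query.vars R := by
  ext x
  simp only [mem_vars, List.mem_append, Set.mem_union]
  grind

theorem vars_cons (A : Atom L V) (Q : Query L V) :
    Query.vars (A :: Q) = A.vars ∪ Query.vars Q := by
  ext x
  simp [mem_vars]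

theorem vars_nil : Query.vars ([] : Query L V) = ∅ := by
  simp [Query.vars]

theorem vars_finite (Q : Query L V) : (Query.vars Q).Finite :=
  Q.finite_toSet.biUnion fun A _ => A.vars_finite

theorem subst_eq_subst_iff {Q : Query L V} {θ η : Subst L V} :
    Query.subst Q θ = Query.subst Q η ↔ Set.EqOn θ.toFun η.toFun (Query.vars Q) := by
  simp only [Query.subst, List.map_inj_left, Atom.subst_eq_subst_iff, Set.EqOn, mem_vars]
  exact ⟨fun h x ⟨A, hA, hx⟩ => h A hA hx, fun h A hA x hx => h ⟨A, hA, hx⟩⟩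

theorem subst_comp (Q : Query L V) (θ η : Subst L V) :
    Query.subst Q (θ.comp η) = Query.subst (Query.subst Q θ) η := by
  simp [Query.subst, Atom.subst_comp]

theorem subst_id (Q : Query L V) : Query.subst Q Subst.id = Q := by
  simp [Query.subst, Atom.subst_id]

theorem subst_append (Q R : Query L V) (θ : Subst L V) :
    Query.subst (Q ++ R) θ = Query.subst Q θ ++ Query.subst R θ :=
  List.map_append

theorem mem_vars_subst {Q : Query L V} {θ : Subst L V} {y : V} :
    y ∈ Query.vars (Query.subst Q θ) ↔ ∃ x ∈ Query.vars Q, y ∈ termVars (θ.toFun x) := by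
  simp only [Query.subst, mem_vars, List.mem_map, exists_exists_and_eq_and, Atom.mem_vars_subst]
  grind

theorem vars_subst_subset (Q : Query L V) (θ : Subst L V) :
    Query.vars (Query.subst Q θ) ⊆ Query.vars Q ∪ θ.vars := by
  intro y hy
  obtain ⟨x, hx, hxy⟩ := mem_vars_subst.1 hy
  rcases θ.termVars_toFun_subset x hxy with rfl | h
  · exact Or.inl hx
  · exact Or.inr h

theorem subst_eq_self {Q : Query L V} {θ : Subst L V} (h : Disjoint (Query.vars Q) θ.vars) :
    Query.subst Q θ = Q := by
  conv_rhs => rw [← subst_id Q]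
  exact subst_eq_subst_iff.2 fun x hx => Subst.eq_var_of_notMem_vars (h.notMem_of_mem_left hx)

end Query

/-! ### Existence of most general unifiers -/

/-- `θ` solves each equation of the list `E`. -/
def Solves (θ : Subst L V) (E : List (L.Term V × L.Term V)) : Prop :=
  ∀ e ∈ E, e.1.subst θ.toFun = e.2.subst θ.toFun

/-- The number of symbol occurrences of a term. -/
def termSize : L.Term V → ℕ
  | Term.var _ => 1
  | Term.func _ ts => 1 + ∑ i, termSize (ts i)

theorem termSize_pos (t : L.Term V) : 0 < termSize t := by
  cases t <;> simp [termSize]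

theorem termSize_le_of_mem {x : V} {t : L.Term V} (f : V → L.Term V) (h : x ∈ termVars t) :
    termSize (f x) ≤ termSize (t.subst f) := by
  induction t with
  | var y => rw [mem_termVars_var.1 h]; rfl
  | func F ts ih =>
    obtain ⟨i, hi⟩ := mem_termVars_func.1 h
    refine (ih i hi).trans ?_
    simp only [Term.subst, termSize]
    exact (Finset.single_le_sum (f := fun i => termSize ((ts i).subst f))
      (fun _ _ => Nat.zero_le _) (Finset.mem_univ i)).trans (Nat.le_add_left _ _)

/-- The occurs check: if `x` lay in a proper subterm of `t`, then `f x` would be strictly smaller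
than `t.subst f`. -/
theorem eq_var_of_mem_of_subst_eq {x : V} {t : L.Term V} {f : V → L.Term V}
    (h : x ∈ termVars t) (heq : f x = t.subst f) : t = Term.var x := by
  cases t with
  | var y => rw [mem_termVars_var.1 h]
  | func F ts =>
    obtain ⟨i, hi⟩ := mem_termVars_func.1 h
    have h₁ := termSize_le_of_mem f hi
    have h₂ : termSize ((ts i).subst f) < termSize (f x) := by
      rw [heq]
      simp only [Term.subst, termSize]
      have := Finset.single_le_sum (f := fun i => termSize ((ts i).subst f))
        (fun _ _ => Nat.zero_le _) (Finset.mem_univ i)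
      omega
    omega

/-- The substitution `x ↦ t`. -/
noncomputable def Subst.single (x : V) (t : L.Term V) : Subst L V :=
  Subst.ofFinite {x} (Set.finite_singleton x) fun _ => t

theorem Subst.single_self (x : V) (t : L.Term V) : (Subst.single x t).toFun x = t :=
  Subst.ofFinite_of_mem _ _ (Set.mem_singleton x)

theorem Subst.single_of_ne {x y : V} (t : L.Term V) (h : y ≠ x) :
    (Subst.single x t).toFun y = Term.var y :=
  Subst.ofFinite_of_notMem _ _ h

theorem Subst.single_comp {x : V} {t : L.Term V} {η : Subst L V}
    (h : η.toFun x = t.subst η.toFun) : (Subst.single x t).comp η = η := by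
  ext y
  rw [Subst.comp_toFun]
  by_cases hy : y = x
  · rw [hy, Subst.single_self, h]
  · rw [Subst.single_of_ne t hy]
    rfl

theorem Subst.single_solves {x : V} {t : L.Term V} (h : x ∉ termVars t) :
    (Subst.single x t).toFun x = t.subst (Subst.single x t).toFun := by
  rw [Subst.single_self]
  conv_lhs => rw [← term_subst_var t]
  refine term_subst_eq_iff.2 fun y hy => (Subst.single_of_ne t ?_).symm
  rintro rfl
  exact h hy

theorem solves_comp_iff {θ η : Subst L V} {E : List (L.Term V × L.Term V)} :
    Solves (θ.comp η) E ↔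
      Solves η (E.map fun e => (e.1.subst θ.toFun, e.2.subst θ.toFun)) := by
  simp only [Solves, List.forall_mem_map, term_subst_subst]
  rfl

/-- `θ` is a most general solution of `E`. -/
def IsMGSolution (θ : Subst L V) (E : List (L.Term V × L.Term V)) : Prop :=
  Solves θ E ∧ ∀ η : Subst L V, Solves η E → ∃ γ : Subst L V, η = θ.comp γ

theorem IsMGSolution.congr {θ : Subst L V} {E F : List (L.Term V × L.Term V)}
    (h : ∀ η : Subst L V, Solves η E ↔ Solves η F) (hθ : IsMGSolution θ E) :
    IsMGSolution θ F :=
  ⟨(h θ).1 hθ.1, fun η hη => hθ.2 η ((h η).2 hη)⟩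

/-- Variable elimination: any solution `η` of `x = t` satisfies `[x ↦ t]η = η`, so it solves the
remaining equations exactly when it solves them after `x` is replaced by `t`. -/
theorem IsMGSolution.cons_var {x : V} {t : L.Term V} (hx : x ∉ termVars t)
    {μ : Subst L V} {E : List (L.Term V × L.Term V)}
    (h : IsMGSolution μ (E.map fun e =>
      (e.1.subst (Subst.single x t).toFun, e.2.subst (Subst.single x t).toFun))) :
    IsMGSolution ((Subst.single x t).comp μ) ((Term.var x, t) :: E) := by
  refine ⟨List.forall_mem_cons.2 ⟨?_, solves_comp_iff.2 h.1⟩, fun η hη => ?_⟩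
  · change ((Subst.single x t).toFun x).subst μ.toFun = _
    rw [Subst.single_solves hx, term_subst_subst]
    rfl
  · obtain ⟨hη₁, hη₂⟩ := List.forall_mem_cons.1 hη
    have hη' : (Subst.single x t).comp η = η := Subst.single_comp hη₁
    rw [← hη'] at hη₂
    obtain ⟨γ, hγ⟩ := h.2 η (solves_comp_iff.1 hη₂)
    exact ⟨γ, by rw [Subst.comp_assoc, ← hγ, hη']⟩

/-- Every solvable finite system of equations between terms has a most general solution. -/
theorem exists_isMGSolution (τ : Subst L V) (n : ℕ) (E : List (L.Term V × L.Term V))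
    (hE : Solves τ E) (hn : (E.map fun e => termSize (e.1.subst τ.toFun)).sum ≤ n) :
    ∃ θ, IsMGSolution θ E := by
  -- The measure is the total size of the left-hand sides instantiated by the known solution `τ`.
  -- Eliminating a variable leaves the instances of the other equations unchanged and drops one
  -- equation; decomposing an equation drops a function symbol.
  induction n generalizing E with
  | zero =>
    cases E with
    | nil => exact ⟨Subst.id, by simp [Solves], fun η _ => ⟨η, rfl⟩⟩
    | cons e E =>
      have := termSize_pos (e.1.subst τ.toFun)
      simp only [List.map_cons, List.sum_cons] at hn
      omega
  | succ n ih =>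
    have elim_var : ∀ (x : V) (t : L.Term V) (E : List (L.Term V × L.Term V)),
        τ.toFun x = t.subst τ.toFun → Solves τ E →
        (E.map fun e => termSize (e.1.subst τ.toFun)).sum ≤ n →
        ∃ θ, IsMGSolution θ ((Term.var x, t) :: E) := by
      intro x t E hxt hE hn
      by_cases hx : x ∈ termVars t
      · obtain rfl := eq_var_of_mem_of_subst_eq hx hxt
        obtain ⟨θ, hθ⟩ := ih E hE hn
        exact ⟨θ, hθ.congr fun η => by simp [Solves]⟩
      · have hτ := Subst.single_comp hxt
        obtain ⟨μ, hμ⟩ := ih (E.map fun e =>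
            (e.1.subst (Subst.single x t).toFun, e.2.subst (Subst.single x t).toFun))
          (solves_comp_iff.1 (by rwa [hτ])) (by
            refine le_trans (le_of_eq ?_) hn
            rw [List.map_map]
            congr 1
            refine List.map_congr_left fun e _ => ?_
            simp only [Function.comp, term_subst_subst, ← Subst.comp_toFun, hτ])
        exact ⟨_, hμ.cons_var hx⟩
    cases E with
    | nil => exact ⟨Subst.id, by simp [Solves], fun η _ => ⟨η, rfl⟩⟩
    | cons e E =>
      obtain ⟨s, t⟩ := e
      obtain ⟨hst, hE'⟩ := List.forall_mem_cons.1 hE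
      replace hE : Solves τ E := hE'
      have hpos := termSize_pos (s.subst τ.toFun)
      simp only [List.map_cons, List.sum_cons] at hn hst
      cases s with
      | var x => exact elim_var x t E hst hE (by omega)
      | func f ts =>
        cases t with
        | var x =>
          obtain ⟨θ, hθ⟩ := elim_var x (Term.func f ts) E hst.symm hE (by omega)
          exact ⟨θ, hθ.congr fun η => by simp [Solves, eq_comm]⟩
        | func g ss =>
          simp only [Term.subst, Term.func.injEq] at hst
          obtain ⟨rfl, hfg, hts⟩ := hst
          obtain rfl := eq_of_heq hfg
          have hts := congrFun (eq_of_heq hts)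
          obtain ⟨θ, hθ⟩ := ih (List.ofFn (fun i => (ts i, ss i)) ++ E)
            (by
              intro e he
              rcases List.mem_append.1 he with he | he
              · obtain ⟨i, rfl⟩ := List.mem_ofFn.1 he
                exact hts i
              · exact hE e he)
            (by
              simp only [Term.subst, termSize] at hn
              simp only [List.map_append, List.sum_append, List.map_ofFn, List.sum_ofFn,
                Function.comp]
              omega)
          refine ⟨θ, hθ.congr fun η => ?_⟩
          simp only [Solves, List.forall_mem_append, List.forall_mem_ofFn_iff,
            List.forall_mem_cons, Term.subst, Term.func.injEq, heq_eq_eq, true_and, funext_iff]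

/-- The unifier `τ` serves only to make the predicate symbols and arities agree; the equations are
then those between corresponding arguments. -/
theorem Atom.exists_equations {A B : Atom L V} {τ : Subst L V} (h : A.subst τ = B.subst τ) :
    ∃ E : List (L.Term V × L.Term V), ∀ η : Subst L V, A.subst η = B.subst η ↔ Solves η E := by
  obtain ⟨n, p, ts⟩ := A
  obtain ⟨m, q, ss⟩ := B
  simp only [Atom.subst, Atom.mk.injEq] at h
  obtain ⟨rfl, hpq, -⟩ := h
  obtain rfl := eq_of_heq hpq
  refine ⟨List.ofFn (fun i => (ts i, ss i)), fun η => ?_⟩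
  simp [Solves, Atom.subst, funext_iff]

theorem Query.exists_equations {Q R : Query L V} {τ : Subst L V} (h : IsUnifier τ Q R) :
    ∃ E : List (L.Term V × L.Term V), ∀ η : Subst L V, IsUnifier η Q R ↔ Solves η E := by
  induction Q generalizing R with
  | nil =>
    cases R with
    | nil => exact ⟨[], fun η => by simp [Solves, IsUnifier]⟩
    | cons B R => simp [IsUnifier, Query.subst] at h
  | cons A Q ih =>
    cases R with
    | nil => simp [IsUnifier, Query.subst] at h
    | cons B R =>
      simp only [IsUnifier, Query.subst, List.map_cons, List.cons.injEq] at h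
      obtain ⟨E, hE⟩ := Atom.exists_equations h.1
      obtain ⟨F, hF⟩ := ih (R := R) h.2
      refine ⟨E ++ F, fun η => ?_⟩
      have := hF η
      simp only [IsUnifier, Query.subst] at this
      simp only [IsUnifier, Query.subst, List.map_cons, List.cons.injEq, hE, this, Solves,
        List.forall_mem_append]

/-- Unifiable queries have a most general unifier. -/
theorem exists_isMGU {Q R : Query L V} {τ : Subst L V} (h : IsUnifier τ Q R) :
    ∃ θ, IsMGU θ Q R := by
  obtain ⟨E, hE⟩ := Query.exists_equations h
  obtain ⟨θ, hθ⟩ := exists_isMGSolution τ _ E ((hE τ).1 h) le_rfl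
  exact ⟨θ, (hE θ).2 hθ.1, fun η hη => hθ.2 η ((hE η).1 hη)⟩

/-! ### Variants -/

theorem eq_var_of_subst_eq_var {t : L.Term V} {f : V → L.Term V} {x : V}
    (h : t.subst f = Term.var x) : ∃ y, t = Term.var y ∧ f y = Term.var x := by
  cases t with
  | var y => exact ⟨y, rfl, h⟩
  | func F ts => simp [Term.subst] at h

/-- Atoms that are instances of each other are variants. -/
theorem Atom.exists_isRenaming_of_subst_subst {A : Atom L V} {μ δ : Subst L V}
    (h : (A.subst μ).subst δ = A) : ∃ ρ : Subst L V, ρ.IsRenaming ∧ A.subst μ = A.subst ρ := by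
  -- Since `μδ` fixes every variable of `A`, `μ` sends these variables to variables, and
  -- injectively, because `δ` sends them back.
  have hvar : ∀ x ∈ A.vars, ∃ y, μ.toFun x = Term.var y ∧ δ.toFun y = Term.var x := by
    rw [← subst_comp] at h
    conv_rhs at h => rw [← A.subst_id]
    exact fun x hx => eq_var_of_subst_eq_var (subst_eq_subst_iff.1 h hx)
  choose! f hf hf' using hvar
  have hinj : A.vars.InjOn f := fun x hx y hy hxy => by
    have := hf' x hx
    rw [hxy, hf' y hy] at this
    exact (Term.var.inj this).symm
  obtain ⟨ρ, hρ, hρf⟩ := Subst.exists_isRenaming_of_injOn (L := L) A.vars_finite hinj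
  exact ⟨ρ, hρ, subst_eq_subst_iff.2 fun x hx => by rw [hf x hx, hρf x hx]⟩

/-- The variables of an atom can be renamed away from a finite set of variables. -/
theorem exists_isRenaming_disjoint [Infinite V] (A : Atom L V) {s : Set V} (hs : s.Finite) :
    ∃ ρ : Subst L V, ρ.IsRenaming ∧ Disjoint (A.subst ρ).vars s := by
  have : Infinite ↥sᶜ := hs.infinite_compl.to_subtype
  have : Finite A.vars := A.vars_finite
  obtain ⟨e⟩ : Nonempty (A.vars ↪ ↥sᶜ) := by
    obtain ⟨n, ⟨e⟩⟩ := Finite.exists_equiv_fin A.vars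
    exact ⟨e.toEmbedding.trans (Fin.valEmbedding.trans (Infinite.natEmbedding _))⟩
  classical
  let f : V → V := fun x => if hx : x ∈ A.vars then e ⟨x, hx⟩ else x
  have hinj : A.vars.InjOn f := fun x hx y hy hxy => by
    simp only [f, hx, hy, dif_pos] at hxy
    simpa using e.injective (Subtype.ext hxy)
  obtain ⟨ρ, hρ, hρf⟩ := Subst.exists_isRenaming_of_injOn (L := L) A.vars_finite hinj
  refine ⟨ρ, hρ, Set.disjoint_left.2 fun y hy hys => ?_⟩
  obtain ⟨x, hx, hxy⟩ := Atom.mem_vars_subst.1 hy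
  rw [hρf x hx, mem_termVars_var] at hxy
  simp only [f, hx, dif_pos] at hxy
  exact (e ⟨x, hx⟩).2 (hxy ▸ hys)

/-- The atoms all of whose variants belong to `S`. -/
def variantCore (S : Set (Atom L V)) : Set (Atom L V) :=
  {A | ∀ ρ : Subst L V, ρ.IsRenaming → A.subst ρ ∈ S}

theorem subst_mem_variantCore {S : Set (Atom L V)} {A : Atom L V} (hA : A ∈ variantCore S)
    {ρ : Subst L V} (hρ : ρ.IsRenaming) : A.subst ρ ∈ variantCore S := fun τ hτ => by
  rw [← Atom.subst_comp]
  exact hA _ (hρ.comp hτ)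

theorem Clause.mem_vars_subst {C : Clause L V} {θ : Subst L V} {y : V} :
    y ∈ (C.subst θ).vars ↔ ∃ x ∈ C.vars, y ∈ termVars (θ.toFun x) := by
  simp only [Clause.vars, Clause.subst, Set.mem_union, Atom.mem_vars_subst,
    Query.mem_vars_subst]
  grind

theorem Subst.IsRenaming.disjoint_of_forall {ρ : Subst L V} (hρ : ρ.IsRenaming)
    {s t s' t' : Set V} (hs : ∀ x ∈ s, termVars (ρ.toFun x) ⊆ s')
    (ht : ∀ x ∈ t, termVars (ρ.toFun x) ⊆ t') (h : Disjoint s' t') : Disjoint s t := by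
  obtain ⟨π, hπ⟩ := hρ
  refine Set.disjoint_left.2 fun x hxs hxt => ?_
  have hx : π x ∈ termVars (ρ.toFun x) := by rw [hπ, mem_termVars_var]
  exact Set.disjoint_left.1 h (hs x hxs hx) (ht x hxt hx)

/-- If `S` is closed under `T^π_P`, the consequences of a variant of a clause of `P` and of atoms
whose variants are all in `S` have all their variants in `S`. -/
theorem head_subst_mem_variantCore {P : Program L V} {S : Set (Atom L V)} (hS : TPi P S ⊆ S)
    {C C' : Clause L V} (hC : C ∈ P) (hvar : C'.IsVariant C) {As : Query L V}
    (hAs : ∀ A ∈ As, A ∈ variantCore S)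
    (hpw : As.Pairwise fun A B => Disjoint A.vars B.vars)
    (hdisj : ∀ A ∈ As, Disjoint A.vars C'.vars)
    {α : Subst L V} (hα : IsMGU α C'.body As) : C'.head.subst α ∈ variantCore S := by
  obtain ⟨ρ, hρ, rfl⟩ := hvar
  obtain ⟨τ, hτ, hρτ, hτρ⟩ := hρ.exists_inverse
  have hAτρ : ∀ A : Atom L V, (A.subst τ).subst ρ = A := fun A => by
    rw [← Atom.subst_comp, hτρ, Atom.subst_id]
  have hvars : ∀ A : Atom L V, ∀ x ∈ (A.subst τ).vars, termVars (ρ.toFun x) ⊆ A.vars :=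
    fun A x hx y hy => by
      rw [← hAτρ A]
      exact Atom.mem_vars_subst.2 ⟨x, hx, hy⟩
  intro κ hκ
  obtain ⟨κ', -, hκκ', -⟩ := hκ.exists_inverse
  have hunif : ∀ η : Subst L V,
      IsUnifier (ρ.comp η) C.body (Query.subst As τ) ↔ IsUnifier η (C.subst ρ).body As :=
    fun η => by
      rw [IsUnifier, IsUnifier, Query.subst_comp, Query.subst_comp, ← Query.subst_comp As,
        hτρ, Query.subst_id]
      rfl
  -- The whole configuration is pulled back along `τ = ρ⁻¹`, since `T^π_P` uses the clause `C`
  -- itself and not its variants. The arbitrary renaming `κ` of the conclusion becomes part of the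
  -- mgu.
  refine hS ⟨C, hC, Query.subst As τ, ?_, ?_, ?_, ρ.comp (α.comp κ), ⟨?_, ?_⟩, ?_⟩
  · exact List.forall_mem_map.2 fun A hA => hAs A hA τ hτ
  · exact List.pairwise_map.2 <| hpw.imp fun {A B} h =>
      hρ.disjoint_of_forall (hvars A) (hvars B) h
  · exact List.forall_mem_map.2 fun A hA => hρ.disjoint_of_forall (hvars A)
      (fun x hx y hy => Clause.mem_vars_subst.2 ⟨x, hx, hy⟩) (hdisj A hA)
  · rw [hunif, IsUnifier, Query.subst_comp, Query.subst_comp, hα.1]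
  · intro η hη
    have hη' : ρ.comp (τ.comp η) = η := by
      rw [← Subst.comp_assoc, hρτ, Subst.id_comp]
    rw [← hη', hunif] at hη
    obtain ⟨γ, hγ⟩ := hα.2 _ hη
    refine ⟨κ'.comp γ, ?_⟩
    rw [Subst.comp_assoc, Subst.comp_assoc, ← Subst.comp_assoc κ, hκκ', Subst.id_comp, ← hγ, hη']
  · rw [Atom.subst_comp, Atom.subst_comp]
    rfl

/-! ### Computed answers and unifiers with atoms of a specification -/

/-- `μ` unifies `Q` and `R`, and every unifier of them agrees on `W` with some `μδ`. -/
def IsMGUOn (W : Set V) (μ : Subst L V) (Q R : Query L V) : Prop :=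
  IsUnifier μ Q R ∧
    ∀ η : Subst L V, IsUnifier η Q R → ∃ δ : Subst L V, Set.EqOn η.toFun (μ.comp δ).toFun W

/-- The atoms of `As` are from `S`, pairwise variable disjoint, and variable disjoint from `U`. -/
structure IsApart (S : Set (Atom L V)) (U : Set V) (As : Query L V) : Prop where
  mem : ∀ A ∈ As, A ∈ S
  pairwise : As.Pairwise fun A B => Disjoint A.vars B.vars
  disjoint : ∀ A ∈ As, Disjoint A.vars U

theorem IsApart.disjoint_vars {S : Set (Atom L V)} {U : Set V} {As : Query L V}
    (h : IsApart S U As) : Disjoint (Query.vars As) U :=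
  Set.disjoint_left.2 fun x hx hxU => by
    obtain ⟨A, hA, hxA⟩ := Query.mem_vars.1 hx
    exact Set.disjoint_left.1 (h.disjoint A hA) hxA hxU

theorem disjoint_vars_of_pairwise_append {As Bs : Query L V}
    (h : (As ++ Bs).Pairwise fun A B => Disjoint A.vars B.vars) :
    Disjoint (Query.vars As) (Query.vars Bs) :=
  Set.disjoint_left.2 fun x hx hx' => by
    obtain ⟨A, hA, hxA⟩ := Query.mem_vars.1 hx
    obtain ⟨B, hB, hxB⟩ := Query.mem_vars.1 hx'
    exact Set.disjoint_left.1 ((List.pairwise_append.1 h).2.2 A hA B hB) hxA hxB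

theorem isUnifier_append {θ : Subst L V} {Q₁ Q₂ R₁ R₂ : Query L V}
    (h : Q₁.length = R₁.length) :
    IsUnifier θ (Q₁ ++ Q₂) (R₁ ++ R₂) ↔ IsUnifier θ Q₁ R₁ ∧ IsUnifier θ Q₂ R₂ := by
  simp only [IsUnifier, Query.subst_append]
  exact List.append_eq_append_iff_of_size_eq_left (by simpa [Query.subst] using h)

theorem IsUnifier.length_eq {θ : Subst L V} {Q R : Query L V} (h : IsUnifier θ Q R) :
    Q.length = R.length := by
  simpa [Query.subst] using congrArg List.length h

theorem SLDDerivation.finite {P : Program L V} {Q₀ Q : Query L V} {σ : Subst L V} {U : Set V}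
    (h : SLDDerivation P Q₀ Q σ U) : U.Finite := by
  induction h with
  | start => exact Query.vars_finite _
  | @step Q Q' σ θ U C C' _ _ _ _ _ ih =>
    exact (ih.union (C'.head.vars_finite.union (Query.vars_finite _))).union θ.vars_finite

/-- Undoing a step preserves the composed substitution only on `U`; the second inclusion ensures
that this suffices to preserve the instance of `Q₀`. -/
theorem SLDDerivation.vars_subset {P : Program L V} {Q₀ Q : Query L V} {σ : Subst L V}
    {U : Set V} (h : SLDDerivation P Q₀ Q σ U) :
    Query.vars Q ⊆ U ∧ Query.vars (Query.subst Q₀ σ) ⊆ U := by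
  induction h with
  | start => exact ⟨subset_rfl, by rw [Query.subst_id]⟩
  | @step Q Q' σ θ U C C' _ _ _ _ hstep ih =>
    obtain ⟨hQ, hσ⟩ := ih
    constructor
    · obtain ⟨pre, post, B, _, hdisj, hmgu⟩ := hstep
      refine (Query.vars_subst_subset _ _).trans ?_
      simp only [Query.vars_append, Query.vars_cons, Set.union_subset_iff, Clause.vars] at hQ ⊢
      grind
    · rw [Query.subst_comp]
      refine (Query.vars_subst_subset _ _).trans ?_
      grind

theorem isUnifier_singleton {θ : Subst L V} {A B : Atom L V} :
    IsUnifier θ [A] [B] ↔ A.subst θ = B.subst θ := by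
  simp [IsUnifier, Query.subst]

theorem isUnifier_append_cons {θ : Subst L V} {Q₁ Q₂ R₁ R₂ : Query L V} {A B : Atom L V}
    (h : Q₁.length = R₁.length) :
    IsUnifier θ (Q₁ ++ A :: Q₂) (R₁ ++ B :: R₂) ↔
      IsUnifier θ Q₁ R₁ ∧ A.subst θ = B.subst θ ∧ IsUnifier θ Q₂ R₂ := by
  rw [isUnifier_append h]
  simp [IsUnifier, Query.subst]

theorem isUnifier_append_append {θ : Subst L V} {Q₁ Q₂ Q₃ R₁ R₂ R₃ : Query L V}
    (h₁ : Q₁.length = R₁.length) (h₂ : Q₂.length = R₂.length) :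
    IsUnifier θ (Q₁ ++ Q₂ ++ Q₃) (R₁ ++ R₂ ++ R₃) ↔
      IsUnifier θ Q₁ R₁ ∧ IsUnifier θ Q₂ R₂ ∧ IsUnifier θ Q₃ R₃ := by
  rw [isUnifier_append (by simp [h₁, h₂]), isUnifier_append h₁, and_assoc]

theorem IsUnifier.congr {θ η : Subst L V} {Q R : Query L V} (h : IsUnifier θ Q R)
    (hQ : Set.EqOn θ.toFun η.toFun (Query.vars Q))
    (hR : Set.EqOn θ.toFun η.toFun (Query.vars R)) : IsUnifier η Q R := by
  rw [IsUnifier, ← Query.subst_eq_subst_iff.2 hQ, ← Query.subst_eq_subst_iff.2 hR, h]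

/-- If `θ` does not move the variables of `R`, then `η` unifies `Qθ` and `R` iff `θη` unifies `Q`
and `R`. -/
theorem isUnifier_subst_iff {θ η : Subst L V} {Q R : Query L V}
    (h : Disjoint (Query.vars R) θ.vars) :
    IsUnifier η (Query.subst Q θ) R ↔ IsUnifier (θ.comp η) Q R := by
  rw [IsUnifier, IsUnifier, Query.subst_comp, Query.subst_comp, Query.subst_eq_self h]

theorem exists_append_append_of_length_eq {Q₁ Q₂ Q₃ R : Query L V}
    (h : (Q₁ ++ Q₂ ++ Q₃).length = R.length) : ∃ R₁ R₂ R₃, R = R₁ ++ R₂ ++ R₃ ∧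
      Q₁.length = R₁.length ∧ Q₂.length = R₂.length := by
  simp only [List.length_append] at h
  refine ⟨R.take Q₁.length, (R.drop Q₁.length).take Q₂.length,
    (R.drop Q₁.length).drop Q₂.length, ?_, ?_, ?_⟩
  · rw [List.append_assoc, List.take_append_drop, List.take_append_drop]
  · rw [List.length_take]
    omega
  · rw [List.length_take, List.length_drop]
    omega

/-- Unifying atoms for an SLD-resolvent of `Q` are turned into unifying atoms for `Q` by
replacing the ones that match the body of the input clause by a consequence of them. -/
theorem SLDStep.exists_isApart [Infinite V] {P : Program L V} {S : Set (Atom L V)}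
    (hS : TPi P S ⊆ S) {C C' : Clause L V} (hC : C ∈ P) (hvar : C'.IsVariant C)
    {Q Q' : Query L V} {θ : Subst L V} {U : Set V} (hU : U.Finite) (hQU : Query.vars Q ⊆ U)
    (hapart : Disjoint C'.vars U) (hstep : SLDStep C' Q θ Q') {As' : Query L V} {μ : Subst L V}
    (hAs' : IsApart (variantCore S) (U ∪ C'.vars ∪ θ.vars) As')
    (hμ : IsMGUOn (U ∪ C'.vars ∪ θ.vars ∪ Query.vars As') μ Q' As') :
    ∃ (As : Query L V) (μ' : Subst L V), IsApart (variantCore S) U As ∧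
      IsMGUOn (U ∪ Query.vars As) μ' Q As ∧ Set.EqOn μ'.toFun (θ.comp μ).toFun U := by
  obtain ⟨pre, post, B, _, -, hθ⟩ := hstep
  have hθu : B.subst θ = C'.head.subst θ := isUnifier_singleton.1 hθ.1
  have hlen := hμ.1.length_eq
  rw [Query.subst, List.length_map] at hlen
  obtain ⟨Apre, Abody, Apost, rfl, hlen₁, hlen₂⟩ := exists_append_append_of_length_eq hlen
  have hdAs := hAs'.disjoint_vars
  simp only [Query.vars_append, Query.vars_cons, Set.disjoint_union_left,
    Set.disjoint_union_right, Set.union_subset_iff] at hdAs hQU hμ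
  have hdθ : Disjoint (Query.vars (Apre ++ Abody ++ Apost)) θ.vars :=
    hAs'.disjoint_vars.mono_right Set.subset_union_right
  have hpw := hAs'.pairwise
  have hd₁ := disjoint_vars_of_pairwise_append hpw
  have hd₂ := disjoint_vars_of_pairwise_append (List.pairwise_append.1 hpw).1
  rw [Query.vars_append, Set.disjoint_union_left] at hd₁
  have hbC : Query.vars C'.body ⊆ C'.vars := Set.subset_union_right
  have hhC : C'.head.vars ⊆ C'.vars := Set.subset_union_left
  obtain ⟨hμpre, hμbody, hμpost⟩ :=
    (isUnifier_append_append hlen₁ hlen₂).1 ((isUnifier_subst_iff hdθ).1 hμ.1)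
  -- `θμ` unifies the body with its atoms, so these have an mgu `α`, with `θμ = αγ`.
  obtain ⟨α, hα⟩ := exists_isMGU hμbody
  obtain ⟨γ, hγ⟩ := hα.2 _ hμbody
  have hcore : C'.head.subst α ∈ variantCore S := by
    refine head_subst_mem_variantCore hS hC hvar (fun A hA => hAs'.mem A (by simp [hA])) ?_
      (fun A hA => (hAs'.disjoint A (by simp [hA])).mono_right ?_) hα
    · exact (List.pairwise_append.1 (List.pairwise_append.1 hpw).1).2.1
    · exact Set.subset_union_right.trans Set.subset_union_left
  -- The consequence is renamed to an atom `A₀` fresh for `U` and for the other atoms, as the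
  -- invariant demands.
  obtain ⟨ρ, hρ, hρd⟩ := exists_isRenaming_disjoint (C'.head.subst α)
    (s := U ∪ Query.vars (Apre ++ Abody ++ Apost)) (hU.union (Query.vars_finite _))
  obtain ⟨τ, -, hρτ, -⟩ := hρ.exists_inverse
  have hA₀core := subst_mem_variantCore hcore hρ
  set A₀ := (C'.head.subst α).subst ρ with hA₀
  simp only [Query.vars_append, Set.disjoint_union_right] at hρd
  -- On the fresh variables of `A₀`, undo the renaming and apply `γ`, so that `A₀` becomes the head
  -- under `αγ = θμ`; elsewhere keep `θμ`.
  set μ' := Subst.piecewise A₀.vars (τ.comp γ) (θ.comp μ)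
  have hμ'out : ∀ s : Set V, Disjoint A₀.vars s → Set.EqOn (θ.comp μ).toFun μ'.toFun s :=
    fun s hs x hx => (Subst.piecewise_of_notMem _ _ (hs.notMem_of_mem_right hx)).symm
  have hμ'in : A₀.subst μ' = (C'.head.subst α).subst γ := by
    rw [Atom.subst_eq_subst_iff.2 fun x hx => Subst.piecewise_of_mem (τ.comp γ) (θ.comp μ) hx,
      hA₀, ← Atom.subst_comp _ ρ, ← Subst.comp_assoc, hρτ, Subst.id_comp]
  have hsub : (Apre ++ Apost).Sublist (Apre ++ Abody ++ Apost) := by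
    rw [List.append_assoc]
    exact (List.Sublist.refl Apre).append (List.sublist_append_right _ _)
  refine ⟨Apre ++ A₀ :: Apost, μ', ⟨?_, ?_, ?_⟩, ⟨?_, fun η hη => ?_⟩,
    (hμ'out U hρd.1).symm⟩
  · rw [List.forall_mem_append, List.forall_mem_cons]
    exact ⟨fun A hA => hAs'.mem A (by simp [hA]), hA₀core, fun A hA => hAs'.mem A (by simp [hA])⟩
  · refine (List.pairwise_middle fun h => h.symm).2
      (List.pairwise_cons.2 ⟨fun A hA => ?_, hpw.sublist hsub⟩)
    have hA' : A.vars ⊆ Query.vars Apre ∪ Query.vars Apost := by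
      rw [← Query.vars_append]
      exact fun x hx => Query.mem_vars.2 ⟨A, hA, hx⟩
    exact (Set.disjoint_union_right.2 ⟨hρd.2.1.1, hρd.2.2⟩).mono_right hA'
  · have hA' : ∀ A ∈ Apre ++ Apost, Disjoint A.vars U := fun A hA =>
      (hAs'.disjoint A (hsub.subset hA)).mono_right
        (Set.subset_union_left.trans Set.subset_union_left)
    rw [List.forall_mem_append] at hA'
    rw [List.forall_mem_append, List.forall_mem_cons]
    exact ⟨hA'.1, hρd.1, hA'.2⟩
  · rw [isUnifier_append_cons hlen₁]
    refine ⟨hμpre.congr (hμ'out _ (hρd.1.mono_right hQU.1)) (hμ'out _ hρd.2.1.1), ?_,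
      hμpost.congr (hμ'out _ (hρd.1.mono_right hQU.2.2)) (hμ'out _ hρd.2.2)⟩
    rw [hμ'in, ← Atom.subst_comp, ← hγ,
      ← Atom.subst_eq_subst_iff.2 (hμ'out _ (hρd.1.mono_right hQU.2.1)), Atom.subst_comp, hθu,
      Atom.subst_comp]
  · obtain ⟨hηpre, hηB, hηpost⟩ := (isUnifier_append_cons hlen₁).1 hη
    -- For generality, a unifier `η` of the old query is redefined on the input clause and the body
    -- atoms, so that the head goes to `A₀η` and the body is unified with its atoms. Then `η₁`
    -- factors through `θ`, and the remaining factor `η₂` unifies the resolvent, hence factors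
    -- through `μ` on the relevant variables.
    set η₁ := Subst.piecewise (C'.vars ∪ Query.vars Abody) (α.comp (ρ.comp η)) η
    have hη₁in : Set.EqOn (α.comp (ρ.comp η)).toFun η₁.toFun (C'.vars ∪ Query.vars Abody) :=
      fun x hx => (Subst.piecewise_of_mem _ _ hx).symm
    have hη₁out : ∀ s : Set V, Disjoint s C'.vars → Disjoint s (Query.vars Abody) →
        Set.EqOn η.toFun η₁.toFun s := fun s h h' x hx =>
      (Subst.piecewise_of_notMem _ _ fun hx' => hx'.elim (h.notMem_of_mem_left hx)
        (h'.notMem_of_mem_left hx)).symm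
    have hη₁U : Set.EqOn η.toFun η₁.toFun U := hη₁out U hapart.symm hdAs.1.1.1.2.symm
    have hη₁pre : Set.EqOn η.toFun η₁.toFun (Query.vars Apre) :=
      hη₁out _ hdAs.1.2.1.1 hd₂
    have hη₁post : Set.EqOn η.toFun η₁.toFun (Query.vars Apost) :=
      hη₁out _ hdAs.1.2.2 hd₁.2.symm
    have hhead : C'.head.subst η₁ = A₀.subst η := by
      rw [← Atom.subst_eq_subst_iff.2 (hη₁in.mono (hhC.trans Set.subset_union_left)),
        Atom.subst_comp, Atom.subst_comp]
    obtain ⟨η₂, hη₂⟩ := hθ.2 η₁ (isUnifier_singleton.2 (by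
      rw [← Atom.subst_eq_subst_iff.2 (hη₁U.mono hQU.2.1), hηB, hhead]))
    obtain ⟨δ, hδ⟩ := hμ.2 η₂ (by
      rw [isUnifier_subst_iff hdθ, ← hη₂, isUnifier_append_append hlen₁ hlen₂]
      refine ⟨hηpre.congr (hη₁U.mono hQU.1) hη₁pre, ?_,
        hηpost.congr (hη₁U.mono hQU.2.2) hη₁post⟩
      refine IsUnifier.congr (θ := α.comp (ρ.comp η)) ?_
        (hη₁in.mono (hbC.trans Set.subset_union_left)) (hη₁in.mono Set.subset_union_right)
      rw [IsUnifier, Query.subst_comp, Query.subst_comp Abody, hα.1])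
    -- `θ` may introduce variables of its own; they lie in `θ.vars`, where `η₂` and `μδ` still
    -- agree.
    have hη₁δ : Set.EqOn η₁.toFun (θ.comp (μ.comp δ)).toFun
        (U ∪ C'.vars ∪ Query.vars (Apre ++ Abody ++ Apost)) := by
      intro x hx
      rw [hη₂, Subst.comp_toFun, Subst.comp_toFun, term_subst_eq_iff]
      intro y hy
      apply hδ
      simp only [Query.vars_append] at hx ⊢
      have := θ.termVars_toFun_subset x hy
      grind
    rw [← Subst.comp_assoc] at hη₁δ
    have hout : ∀ s : Set V, Disjoint A₀.vars s → Set.EqOn η.toFun η₁.toFun s →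
        s ⊆ U ∪ C'.vars ∪ Query.vars (Apre ++ Abody ++ Apost) →
        Set.EqOn η.toFun (μ'.comp δ).toFun s := fun s hs h h' x hx => by
      rw [h hx, hη₁δ (h' hx), Subst.comp_toFun, hμ'out s hs hx, Subst.comp_toFun]
    refine ⟨δ, ?_⟩
    simp only [Query.vars_append, Query.vars_cons, Set.eqOn_union] at hout ⊢
    refine ⟨hout _ hρd.1 hη₁U (by grind), hout _ hρd.2.1.1 hη₁pre (by grind), ?_,
      hout _ hρd.2.2 hη₁post (by grind)⟩
    -- On `A₀` the claim follows from comparing instances of the head `H`: `A₀η = Hη₁ = Hθμδ = Hαγδ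
    -- = A₀μ'δ`.
    rw [← Atom.subst_eq_subst_iff, ← hhead, Atom.subst_comp, hμ'in,
      Atom.subst_eq_subst_iff.2 (hη₁δ.mono (by grind)), Atom.subst_comp, hγ, Atom.subst_comp]

/-- The answer of an SLD-derivation from `Q₀` to `Q`, followed by a most general unifier of `Q`
and atoms of the specification, is given by a most general unifier of `Q₀` and such atoms. -/
theorem SLDDerivation.exists_isApart [Infinite V] {P : Program L V} {S : Set (Atom L V)}
    (hS : TPi P S ⊆ S) {Q₀ Q : Query L V} {σ : Subst L V} {U : Set V}
    (h : SLDDerivation P Q₀ Q σ U) {As : Query L V} {μ : Subst L V}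
    (hAs : IsApart (variantCore S) U As) (hμ : IsMGUOn (U ∪ Query.vars As) μ Q As) :
    ∃ (As₀ : Query L V) (μ₀ : Subst L V), IsApart (variantCore S) (Query.vars Q₀) As₀ ∧
      IsMGUOn (Query.vars Q₀ ∪ Query.vars As₀) μ₀ Q₀ As₀ ∧
      Query.subst Q₀ (σ.comp μ) = Query.subst Q₀ μ₀ := by
  induction h generalizing As μ with
  | start => exact ⟨As, μ, hAs, hμ, rfl⟩
  | step hder hC hvar hapart hstep ih =>
    obtain ⟨As', μ', hAs', hμ', heq⟩ := hstep.exists_isApart hS hC hvar hder.finite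
      hder.vars_subset.1 hapart hAs hμ
    obtain ⟨As₀, μ₀, hAs₀, hμ₀, heq₀⟩ := ih hAs' hμ'
    refine ⟨As₀, μ₀, hAs₀, hμ₀, ?_⟩
    rw [← heq₀, Subst.comp_assoc, Query.subst_comp, Query.subst_comp _ _ μ',
      Query.subst_eq_subst_iff.2 (heq.mono hder.vars_subset.2)]

/-! ### Most general atomic queries and correctness. -/

/-- Binding the distinct variables `x i` to the arguments of `A` is a unifier that fixes `A`. By
generality of `μ` on `A.vars`, `A` is an instance of `Aμ`, so `Aμ` is a variant of `A` and lies in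
`S`. -/
theorem subst_ofVars_mem {S : Set (Atom L V)} {n : ℕ} {p : L.Relations n} {x : Fin n → V}
    (hx : Function.Injective x) {A : Atom L V} (hA : A ∈ variantCore S)
    (hdisj : Disjoint A.vars (Atom.ofVars p x).vars) {μ : Subst L V}
    (hμ : IsMGUOn A.vars μ [Atom.ofVars p x] [A]) : (Atom.ofVars p x).subst μ ∈ S := by
  have hu := isUnifier_singleton.1 hμ.1
  rw [hu]
  obtain ⟨m, q, ts⟩ := A
  have hu' := hu
  simp only [Atom.subst, Atom.ofVars, Atom.mk.injEq] at hu'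
  obtain ⟨rfl, hpq, -⟩ := hu'
  obtain rfl := eq_of_heq hpq
  set η := Subst.ofFinite (Set.range x) (Set.finite_range x)
    (Function.extend x ts Term.var) with hη
  have h₁ : (Atom.ofVars p x).subst η = ⟨n, p, ts⟩ := by
    simp only [Atom.subst, Atom.ofVars, Atom.mk.injEq, heq_eq_eq, true_and]
    funext i
    rw [Term.subst, hη, Subst.ofFinite_of_mem _ _ (Set.mem_range_self i), hx.extend_apply]
  have h₂ : (⟨n, p, ts⟩ : Atom L V).subst η = ⟨n, p, ts⟩ := by
    conv_rhs => rw [← Atom.subst_id ⟨n, p, ts⟩]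
    refine Atom.subst_eq_subst_iff.2 fun y hy => Subst.ofFinite_of_notMem _ _ ?_
    rintro ⟨i, rfl⟩
    exact hdisj.notMem_of_mem_left hy (Set.mem_iUnion.2 ⟨i, mem_termVars_var.2 rfl⟩)
  obtain ⟨δ, hδ⟩ := hμ.2 η (isUnifier_singleton.2 (h₁.trans h₂.symm))
  rw [← Atom.subst_eq_subst_iff, h₂, Atom.subst_comp] at hδ
  obtain ⟨ρ, hρ, h⟩ := Atom.exists_isRenaming_of_subst_subst hδ.symm
  rw [h]
  exact hA ρ hρ

theorem isCorrect_of_TPi_subset [Infinite V] {P : Program L V} {S : Set (Atom L V)}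
    (hS : TPi P S ⊆ S) : IsCorrect P S := by
  rintro A ⟨n, p, x, hx, σ, U, hder, hA⟩
  -- The derivation ends in the empty query, which the identity unifies most generally with the
  -- empty list of atoms.
  obtain ⟨As, μ, hAs, hμ, heq⟩ := hder.exists_isApart hS (As := []) (μ := Subst.id)
    ⟨by simp, List.Pairwise.nil, by simp⟩
    ⟨rfl, fun η _ => ⟨η, by rw [Subst.id_comp]; exact Set.eqOn_refl _ _⟩⟩
  rw [Subst.comp_id, ← hA] at heq
  obtain ⟨A₀, rfl⟩ := List.length_eq_one_iff.1 hμ.1.length_eq.symm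
  obtain rfl : A = (Atom.ofVars p x).subst μ := by simpa [Query.subst] using heq
  have hd := hAs.disjoint_vars
  simp only [Query.vars_cons, Query.vars_nil, Set.union_empty] at hd hμ
  refine subst_ofVars_mem hx (hAs.mem A₀ (by simp)) hd ⟨hμ.1, fun η hη => ?_⟩
  obtain ⟨δ, hδ⟩ := hμ.2 η hη
  exact ⟨δ, hδ.mono Set.subset_union_right⟩

theorem TPi_subset_iff {P : Program L V} {S : Set (Atom L V)} :
    TPi P S ⊆ S ↔ ∀ C ∈ P, TPi {C} S ⊆ S := by
  constructor
  · rintro h C hC A ⟨_, rfl, hA⟩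
    exact h ⟨_, hC, hA⟩
  · rintro h A ⟨C, hC, hA⟩
    exact h C hC ⟨C, rfl, hA⟩

end SSem

theorem theorem1 {L : FirstOrder.Language.{u, v}} {V : Type w} [Infinite V]
    (P : SSem.Program L V) (S : Set (SSem.Atom L V)) :
    (SSem.TPi P S ⊆ S → SSem.IsCorrect P S) ∧
    ((∀ C ∈ P, SSem.TPi {C} S ⊆ S) → SSem.IsCorrect P S) ∧
    (SSem.TPi P S ⊆ S ↔ ∀ C ∈ P, SSem.TPi {C} S ⊆ S) :=
  ⟨SSem.isCorrect_of_TPi_subset, fun h => SSem.isCorrect_of_TPi_subset (SSem.TPi_subset_iff.2 h),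
    SSem.TPi_subset_iff⟩
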